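/- Let $K$ be a triangulation of a region in the Euclidean plane, i.e. a geometric simplicial complex in $\mathbb{R}^2$. A \emph{1-spoke} is a 2-simplex of $K$, that is, the closed, convex filled triangle spanned by three affinely independent vertices forming a face of $K$. Let $T$ be a finite collection of 1-spokes. (No common vertex of the 1-spokes in $T$ is assumed; collections whose members all share a vertex are included as a special case.) The nerve of $T$, $$\mathrm{Nrv}\,T=\Bigl\{\sigma\subseteq T:\ \sigma\neq\emptyset,\ \bigcap_{A\in\sigma}A\neq\emptyset\Bigr\},$$ is an abstract simplicial complex with vertex set $T$; its geometric realization $|\mathrm{Nrv}\,T|$ is the set of points of the standard simplex on $T$ (barycentric coordinates) whose support belongs to $\mathrm{Nrv}\,T$, with the topology induced from $\mathbb{R}^T$. Then $|\mathrm{Nrv}\,T|$ and the union $\bigcup_{A\in T}A\subseteq\mathbb{R}^2$ (with the subspace topology) have the same homotopy type: there are continuous maps $f:|\mathrm{Nrv}\,T|\to\bigcup_{A\in T}A$ and $g:\bigcup_{A\in T}A\to|\mathrm{Nrv}\,T|$ such that $g\circ f$ and $f\circ g$ are homotopic to the respective identity maps. -/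

import Mathlib

/-- The Euclidean plane. -/
abbrev Plane : Type := EuclideanSpace ℝ (Fin 2)

/-- A 1-spoke of a planar triangulation `K`, given by its vertex set:
a 2-simplex of `K`, that is, a face of `K` with exactly three vertices. -/
def IsOneSpoke (K : Geometry.SimplicialComplex ℝ Plane) (s : Finset Plane) : Prop :=
  s ∈ K.faces ∧ s.card = 3

/-- The filled triangle (boundary and interior) spanned by a finite set of vertices. -/
def filledTriangle (s : Finset Plane) : Set Plane :=
  convexHull ℝ (s : Set Plane)

/-- The nerve of a family of sets: the abstract simplicial complex on the index type whose faces
are the nonempty finite subfamilies with a common point. -/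
def nerveComplex {ι X : Type*} (A : ι → Set X) : PreAbstractSimplicialComplex ι where
  faces := {s | s.Nonempty ∧ (⋂ i ∈ s, A i).Nonempty}
  isRelLowerSet_faces := by
    rintro s ⟨hs, hA⟩
    refine ⟨hs, fun t hts ht => ⟨ht, hA.mono ?_⟩⟩
    exact Set.biInter_subset_biInter_left (fun i hi => hts hi)

/-- The geometric realization of an abstract simplicial complex on a finite vertex type: the points
of the standard simplex (in barycentric coordinates) whose support is a face, with the topology
induced from `ι → ℝ`. -/
def geometricRealization {ι : Type*} [Fintype ι] (N : PreAbstractSimplicialComplex ι) :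
    Set (ι → ℝ) :=
  {x | x ∈ stdSimplex ℝ ι ∧ ∃ s ∈ N.faces, ∀ i, i ∈ s ↔ x i ≠ 0}

/-! This is the nerve theorem for finitely many nonempty compact convex sets. The map `f` sends `t`
to an average of points chosen in the common intersections of faces, weighted so that it lies in `A
i` whenever `t i` is maximal (`faceAverage_mem`). The map `g` normalizes bump functions `γ` that
peak exactly on the sets; their width `ε` is so small that supports are faces
(`exists_pos_forall_infDist_lt_imp_nonempty`). All homotopies are straight lines, each inside one
convex set or one closed face. -/

/-- Two maps into a subset of a real topological vector space are homotopic if the segments between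
their values stay in the subset. -/
theorem homotopic_of_segment_subset {Y F : Type*} [TopologicalSpace Y] [AddCommGroup F]
    [Module ℝ F] [TopologicalSpace F] [IsTopologicalAddGroup F] [ContinuousSMul ℝ F] {S : Set F}
    (u v : C(Y, S)) (h : ∀ y, segment ℝ (u y : F) (v y) ⊆ S) : u.Homotopic v := by
  refine ⟨⟨⟨fun q => ⟨AffineMap.lineMap (u q.2 : F) (v q.2 : F) (q.1 : ℝ), h q.2 ?_⟩, ?_⟩, ?_, ?_⟩⟩
  · rw [segment_eq_image_lineMap]
    exact ⟨q.1, q.1.2, rfl⟩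
  · refine Continuous.subtype_mk ?_ _
    simp only [AffineMap.lineMap_apply_module]
    fun_prop
  · intro y
    simp
  · intro y
    simp

section Realization

variable {ι : Type*} [Fintype ι]

theorem mem_geometricRealization_of_support_subset {N : PreAbstractSimplicialComplex ι}
    {s : Finset ι} (hs : s ∈ N.faces) {x : ι → ℝ} (hx : x ∈ stdSimplex ℝ ι)
    (hxs : ∀ i, x i ≠ 0 → i ∈ s) : x ∈ geometricRealization N := by
  classical
  refine ⟨hx, Finset.univ.filter (fun i => x i ≠ 0), ?_, fun i => by simp⟩
  refine (N.isRelLowerSet_faces hs).2 (fun i hi => hxs i (by simpa using hi)) ?_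
  by_contra hne
  have hz : ∀ i, x i = 0 := by simpa [Finset.not_nonempty_iff_eq_empty,
    Finset.filter_eq_empty_iff] using hne
  have h1 := hx.2
  simp [hz] at h1

theorem segment_subset_geometricRealization {N : PreAbstractSimplicialComplex ι}
    {s : Finset ι} (hs : s ∈ N.faces) {x y : ι → ℝ} (hx : x ∈ stdSimplex ℝ ι)
    (hy : y ∈ stdSimplex ℝ ι) (hxs : ∀ i, x i ≠ 0 → i ∈ s) (hys : ∀ i, y i ≠ 0 → i ∈ s) :
    segment ℝ x y ⊆ geometricRealization N := by
  intro z hz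
  refine mem_geometricRealization_of_support_subset hs
    ((convex_stdSimplex ℝ ι).segment_subset hx hy hz) fun i hi => ?_
  obtain ⟨a, b, -, -, -, rfl⟩ := hz
  by_contra his
  have h1 : x i = 0 := by_contra fun h => his (hxs i h)
  have h2 : y i = 0 := by_contra fun h => his (hys i h)
  simp [h1, h2] at hi

/-- A vector rescaled to have coordinate sum one. -/
noncomputable def sumNormalize (c : ι → ℝ) : ι → ℝ := (∑ i, c i)⁻¹ • c

theorem sumNormalize_mem_stdSimplex {c : ι → ℝ} (hc : ∀ i, 0 ≤ c i) {i : ι} (hi : 0 < c i) :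
    sumNormalize c ∈ stdSimplex ℝ ι := by
  have hpos : 0 < ∑ i, c i := Finset.sum_pos' (fun i _ => hc i) ⟨i, Finset.mem_univ i, hi⟩
  refine ⟨fun j => mul_nonneg (inv_nonneg.2 hpos.le) (hc j), ?_⟩
  simp only [sumNormalize, Pi.smul_apply, smul_eq_mul, ← Finset.mul_sum]
  exact inv_mul_cancel₀ hpos.ne'

theorem ne_zero_of_sumNormalize_ne_zero {c : ι → ℝ} {i : ι} (h : sumNormalize c i ≠ 0) :
    c i ≠ 0 :=
  right_ne_zero_of_mul h

theorem continuous_sumNormalize {Y : Type*} [TopologicalSpace Y] {c : Y → ι → ℝ}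
    (hc : Continuous c) (hpos : ∀ y, sumNormalize (c y) ∈ stdSimplex ℝ ι) :
    Continuous fun y => sumNormalize (c y) := by
  have hne : ∀ y, ∑ i, c y i ≠ 0 := by
    intro y h0
    -- Since `0⁻¹ = 0`, a vanishing sum would normalize to the zero vector, which is not in the
    -- simplex.
    have h1 := (hpos y).2
    simp [sumNormalize, h0] at h1
  unfold sumNormalize
  exact Continuous.smul (Continuous.inv₀ (by fun_prop) hne) hc

theorem exists_eq_norm_of_mem_stdSimplex {t : ι → ℝ} (ht : t ∈ stdSimplex ℝ ι) :
    ∃ i, t i = ‖t‖ ∧ 0 < t i := by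
  have hne : Nonempty ι := by
    by_contra h
    rw [not_nonempty_iff] at h
    have h1 := ht.2
    simp at h1
  obtain ⟨i, hi⟩ := Finite.exists_max t
  have hnorm : t i = ‖t‖ := by
    refine le_antisymm ((le_abs_self _).trans (norm_le_pi_norm t i)) ?_
    refine (pi_norm_le_iff_of_nonneg (ht.1 i)).2 fun j => ?_
    rw [Real.norm_of_nonneg (ht.1 j)]
    exact hi j
  refine ⟨i, hnorm, (ht.1 i).lt_of_ne fun h0 => ?_⟩
  have hz : t = 0 := norm_eq_zero.1 (hnorm.symm.trans h0.symm)
  have h1 := ht.2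
  simp [hz] at h1

end Realization

section Nerve

variable {ι E : Type*} [Fintype ι]

/-- If finitely many members of a finite family of compact sets are all close to one point, they
have a common point. -/
theorem exists_pos_forall_infDist_lt_imp_nonempty [MetricSpace E] {A : ι → Set E}
    (hA : ∀ i, IsCompact (A i)) (hne : ∀ i, (A i).Nonempty) :
    ∃ ε > 0, ∀ x ∈ ⋃ i, A i, ∀ s : Finset ι,
      (∀ i ∈ s, Metric.infDist x (A i) < ε) → (⋂ i ∈ s, A i).Nonempty := by
  have key : ∀ s : Finset ι, ∃ ε > 0, ∀ x ∈ ⋃ i, A i,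
      (∀ i ∈ s, Metric.infDist x (A i) < ε) → (⋂ i ∈ s, A i).Nonempty := by
    intro s
    rcases s.eq_empty_or_nonempty with rfl | hs
    · exact ⟨1, one_pos, fun x _ _ => ⟨x, by simp⟩⟩
    have hcont : Continuous fun x => ∑ i ∈ s, Metric.infDist x (A i) :=
      continuous_finsetSum _ fun i _ => Metric.continuous_infDist_pt _
    have hX : IsCompact (⋃ i, A i) := isCompact_iUnion hA
    have hXne : (⋃ i, A i).Nonempty := by
      obtain ⟨i, -⟩ := hs
      exact (hne i).mono (Set.subset_iUnion A i)
    obtain ⟨x₀, -, hmin⟩ := hX.exists_isMinOn hXne hcont.continuousOn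
    rcases (Finset.sum_nonneg fun i (_ : i ∈ s) =>
      Metric.infDist_nonneg (x := x₀) (s := A i)).eq_or_lt with h0 | hpos
    · refine ⟨1, one_pos, fun _ _ _ => ⟨x₀, Set.mem_iInter₂.2 fun i hi => ?_⟩⟩
      rw [(hA i).isClosed.mem_iff_infDist_zero (hne i)]
      exact (Finset.sum_eq_zero_iff_of_nonneg fun _ _ => Metric.infDist_nonneg).1 h0.symm i hi
    · have hcard : (0 : ℝ) < s.card := by exact_mod_cast hs.card_pos
      -- The bound is the minimal distance sum divided by `s.card`: if every distance were smaller,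
      -- their sum would drop below the minimum.
      refine ⟨_, div_pos hpos hcard, fun x hx hlt => ?_⟩
      exfalso
      have h1 := Finset.sum_lt_sum_of_nonempty hs hlt
      rw [Finset.sum_const, nsmul_eq_mul, mul_div_cancel₀ _ hcard.ne'] at h1
      exact absurd (isMinOn_iff.1 hmin x hx) (not_le.2 h1)
  choose ε hε h using key
  obtain ⟨s₀, hs₀⟩ := Finite.exists_min ε
  exact ⟨ε s₀, hε s₀, fun x hx s hs => h s x hx fun i hi => (hs i hi).trans_le (hs₀ s)⟩

/-- The weight of the face `s` at the point `t`: positive exactly when `s` lies between the set of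
indices of maximal coordinates of `t` and the support of `t`. -/
noncomputable def faceWeight [DecidableEq ι] (t : ι → ℝ) (s : Finset ι) : ℝ :=
  (∏ i ∈ s, t i) * ∏ i ∈ sᶜ, (‖t‖ - t i)

/-- Expand `∏ i, (t i + (‖t‖ - t i))`. Hence the total weight is nonzero on the simplex. -/
theorem sum_faceWeight [DecidableEq ι] (t : ι → ℝ) :
    ∑ s, faceWeight t s = ‖t‖ ^ Fintype.card ι := by
  have h := Finset.prod_add t (fun i => ‖t‖ - t i) Finset.univ
  simp only [add_sub_cancel, Finset.prod_const, Finset.card_univ, Finset.powerset_univ] at h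
  simp only [faceWeight, h, Finset.compl_eq_univ_sdiff]

theorem faceWeight_nonneg [DecidableEq ι] {t : ι → ℝ} (ht : ∀ i, 0 ≤ t i) (s : Finset ι) :
    0 ≤ faceWeight t s :=
  mul_nonneg (Finset.prod_nonneg fun i _ => ht i) <| Finset.prod_nonneg fun i _ =>
    sub_nonneg.2 ((le_abs_self _).trans (norm_le_pi_norm t i))

variable [NormedAddCommGroup E] [NormedSpace ℝ E]

/-- The map from the realization of the nerve given by averaging chosen points of the faces. -/
noncomputable def faceAverage [DecidableEq ι] (p : Finset ι → E) (t : ι → ℝ) : E :=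
  Finset.univ.centerMass (faceWeight t) p

theorem continuousOn_faceAverage [DecidableEq ι] (p : Finset ι → E) :
    ContinuousOn (faceAverage p) (stdSimplex ℝ ι) := by
  unfold faceAverage Finset.centerMass
  have hw : ∀ s, Continuous fun t : ι → ℝ => faceWeight t s := fun s => by
    unfold faceWeight
    fun_prop
  refine ContinuousOn.smul (ContinuousOn.inv₀ (by fun_prop) fun t ht => ?_) (by fun_prop)
  rw [sum_faceWeight]
  obtain ⟨i, hi, hpos⟩ := exists_eq_norm_of_mem_stdSimplex ht
  exact pow_ne_zero _ (hi ▸ hpos.ne')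

theorem faceAverage_mem [DecidableEq ι] {A : ι → Set E} (hconv : ∀ i, Convex ℝ (A i))
    {p : Finset ι → E} (hp : ∀ s ∈ (nerveComplex A).faces, ∀ i ∈ s, p s ∈ A i) {t : ι → ℝ}
    (ht : t ∈ geometricRealization (nerveComplex A)) {i : ι} (hi : t i = ‖t‖) :
    faceAverage p t ∈ A i := by
  obtain ⟨htS, s₀, hs₀, hsupp⟩ := ht
  obtain ⟨j, hj, hjpos⟩ := exists_eq_norm_of_mem_stdSimplex htS
  unfold faceAverage
  rw [← Finset.centerMass_filter_ne_zero]
  refine (hconv i).centerMass_mem (fun s _ => faceWeight_nonneg htS.1 s) ?_ fun s hs => ?_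
  · rw [Finset.sum_filter_ne_zero, sum_faceWeight]
    exact pow_pos (hj ▸ hjpos) _
  · have hw : faceWeight t s ≠ 0 := (Finset.mem_filter.1 hs).2
    have his : i ∈ s := by
      by_contra his
      exact right_ne_zero_of_mul hw
        (Finset.prod_eq_zero (Finset.mem_compl.2 his) (sub_eq_zero.2 hi.symm))
    have hsub : s ⊆ s₀ := fun k hk =>
      (hsupp k).2 (Finset.prod_ne_zero_iff.1 (left_ne_zero_of_mul hw) k hk)
    exact hp s (((nerveComplex A).isRelLowerSet_faces hs₀).2 hsub ⟨i, his⟩) i his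

/-- The nerve theorem for finite families of nonempty compact convex sets. -/
theorem nonempty_homotopyEquiv_nerveComplex {A : ι → Set E} (hA : ∀ i, IsCompact (A i))
    (hconv : ∀ i, Convex ℝ (A i)) (hne : ∀ i, (A i).Nonempty) :
    Nonempty (ContinuousMap.HomotopyEquiv
      ↥(geometricRealization (nerveComplex A)) ↥(⋃ i, A i)) := by
  classical
  obtain ⟨ε, hε, hclose⟩ := exists_pos_forall_infDist_lt_imp_nonempty hA hne
  have hp : ∀ s : Finset ι, ∃ p : E, s ∈ (nerveComplex A).faces → ∀ i ∈ s, p ∈ A i := by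
    intro s
    by_cases hs : s ∈ (nerveComplex A).faces
    · obtain ⟨p, hp⟩ := hs.2
      exact ⟨p, fun _ => by simpa using hp⟩
    -- The value on non-faces is harmless: their weights vanish on the realization.
    · exact ⟨0, fun h => absurd h hs⟩
  choose p hp using hp
  have havg : ∀ {t : ι → ℝ}, t ∈ geometricRealization (nerveComplex A) → ∀ {i}, t i = ‖t‖ →
      faceAverage p t ∈ A i := fun ht _ hi => faceAverage_mem hconv hp ht hi
  have hfmem : ∀ t : geometricRealization (nerveComplex A), faceAverage p t.1 ∈ ⋃ i, A i :=
    fun t => by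
      obtain ⟨i, hi, -⟩ := exists_eq_norm_of_mem_stdSimplex t.2.1
      exact Set.mem_iUnion.2 ⟨i, havg t.2 hi⟩
  let f : C(geometricRealization (nerveComplex A), ⋃ i, A i) :=
    ⟨fun t => ⟨faceAverage p t, hfmem t⟩,
      Continuous.subtype_mk ((continuousOn_faceAverage p).comp_continuous continuous_subtype_val
        fun t => t.2.1) hfmem⟩
  let γ : E → ι → ℝ := fun x i => max 0 (ε - Metric.infDist x (A i))
  have hγc : Continuous γ := continuous_pi fun i =>
    continuous_const.max (continuous_const.sub (Metric.continuous_infDist_pt _))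
  have hγ0 : ∀ x i, 0 ≤ γ x i := fun x i => le_max_left _ _
  have hγle : ∀ x i, γ x i ≤ ε := fun x i =>
    max_le hε.le (sub_le_self _ Metric.infDist_nonneg)
  have hγmem : ∀ {x i}, x ∈ A i → γ x i = ε := fun {x i} hx => by
    simp [γ, Metric.infDist_zero_of_mem hx, hε.le]
  have hγeq : ∀ {x i}, γ x i = ε → x ∈ A i := fun {x i} hx => by
    rw [(hA i).isClosed.mem_iff_infDist_zero (hne i)]
    have h0 := Metric.infDist_nonneg (x := x) (s := A i)
    rcases max_choice 0 (ε - Metric.infDist x (A i)) with h | h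
    · exact absurd (h.symm.trans hx) hε.ne
    · have := h.symm.trans hx
      linarith
  have hγS : ∀ {x}, x ∈ ⋃ i, A i → sumNormalize (γ x) ∈ stdSimplex ℝ ι := fun {x} hx => by
    obtain ⟨i, hi⟩ := Set.mem_iUnion.1 hx
    exact sumNormalize_mem_stdSimplex (hγ0 x) (i := i) (by rw [hγmem hi]; exact hε)
  let σ : E → Finset ι := fun x => Finset.univ.filter fun i => γ x i ≠ 0
  have hσ : ∀ {x}, x ∈ ⋃ i, A i → σ x ∈ (nerveComplex A).faces := fun {x} hx => by
    refine ⟨?_, hclose x hx _ fun i hi => ?_⟩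
    · obtain ⟨i, hi⟩ := Set.mem_iUnion.1 hx
      exact ⟨i, Finset.mem_filter.2 ⟨Finset.mem_univ i, by rw [hγmem hi]; exact hε.ne'⟩⟩
    · have hi' := (Finset.mem_filter.1 hi).2
      by_contra hge
      exact hi' (max_eq_left (by linarith [not_lt.1 hge]))
  have hγσ : ∀ x i, sumNormalize (γ x) i ≠ 0 → i ∈ σ x := fun x i h =>
    Finset.mem_filter.2 ⟨Finset.mem_univ i, ne_zero_of_sumNormalize_ne_zero h⟩
  let g : C(⋃ i, A i, geometricRealization (nerveComplex A)) :=
    ⟨fun x => ⟨sumNormalize (γ x),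
      mem_geometricRealization_of_support_subset (hσ x.2) (hγS x.2) (hγσ x)⟩,
      Continuous.subtype_mk (continuous_sumNormalize (hγc.comp continuous_subtype_val)
        fun x => hγS x.2) _⟩
  -- The product is supported in both `t` and `g (f t)`, so `h` is joined by segments to each of `g
  -- ∘ f` and the identity. It is nonzero at a maximal coordinate of `t`.
  let c : geometricRealization (nerveComplex A) → ι → ℝ := fun t i => t.1 i * γ (f t) i
  have hcc : Continuous c := by
    have : Continuous fun t => γ (f t) := hγc.comp (continuous_subtype_val.comp f.continuous)
    exact continuous_subtype_val.mul this
  have hcS : ∀ t, sumNormalize (c t) ∈ stdSimplex ℝ ι := fun t => by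
    obtain ⟨i, hi, hpos⟩ := exists_eq_norm_of_mem_stdSimplex t.2.1
    refine sumNormalize_mem_stdSimplex (fun j => mul_nonneg (t.2.1.1 j) (hγ0 _ j)) (i := i) ?_
    exact mul_pos hpos (hε.trans_eq (hγmem (havg t.2 hi)).symm)
  have hcσ : ∀ t i, sumNormalize (c t) i ≠ 0 → i ∈ σ (f t) := fun t i h =>
    Finset.mem_filter.2 ⟨Finset.mem_univ i,
      right_ne_zero_of_mul (ne_zero_of_sumNormalize_ne_zero (c := c t) h)⟩
  let h : C(geometricRealization (nerveComplex A), geometricRealization (nerveComplex A)) :=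
    ⟨fun t => ⟨sumNormalize (c t),
      mem_geometricRealization_of_support_subset (hσ (f t).2) (hcS t) (hcσ t)⟩,
      Continuous.subtype_mk (continuous_sumNormalize hcc hcS) _⟩
  refine ⟨⟨f, g, ?_, ?_⟩⟩
  · have h₁ : (g.comp f).Homotopic h := homotopic_of_segment_subset _ _ fun t =>
      segment_subset_geometricRealization (hσ (f t).2) (hγS (f t).2) (hcS t) (hγσ _) (hcσ t)
    have h₂ : h.Homotopic (ContinuousMap.id _) := homotopic_of_segment_subset _ _ fun t => by
      obtain ⟨s, hs, hts⟩ := t.2.2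
      exact segment_subset_geometricRealization hs (hcS t) t.2.1
        (fun i hi => (hts i).2 (left_ne_zero_of_mul (ne_zero_of_sumNormalize_ne_zero (c := c t) hi)))
        fun i hi => (hts i).2 hi
    exact h₁.trans h₂
  · refine homotopic_of_segment_subset _ _ fun x => ?_
    obtain ⟨j, hj⟩ := Set.mem_iUnion.1 x.2
    obtain ⟨i, hi, -⟩ := exists_eq_norm_of_mem_stdSimplex (hγS x.2)
    have hpos : 0 < ∑ i, γ x i := Finset.sum_pos' (fun i _ => hγ0 _ i)
      ⟨j, Finset.mem_univ j, by rw [hγmem hj]; exact hε⟩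
    have hji : sumNormalize (γ x) j ≤ sumNormalize (γ x) i := by
      rw [hi]
      exact (le_abs_self _).trans (norm_le_pi_norm (sumNormalize (γ x)) j)
    -- Some `γ x j` attains the bound `ε`, so a maximal coordinate of `g x` does too; hence `x` and
    -- `f (g x)` share the set `A i`.
    have hεi : ε ≤ γ x i := by
      rw [← hγmem hj]
      exact le_of_mul_le_mul_left hji (inv_pos.2 hpos)
    have hxi : (x : E) ∈ A i := hγeq (le_antisymm (hγle _ _) hεi)
    exact ((hconv i).segment_subset (havg (g x).2 hi) hxi).trans (Set.subset_iUnion A i)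

end Nerve

theorem mainTheorem2 (K : Geometry.SimplicialComplex ℝ Plane) (T : Finset (Finset Plane))
    (hT : ∀ s ∈ T, IsOneSpoke K s) :
    Nonempty (ContinuousMap.HomotopyEquiv
      ↥(geometricRealization (nerveComplex (fun s : ↥T => filledTriangle s.1)))
      ↥(⋃ s ∈ T, filledTriangle s)) := by
  have hX : ⋃ s ∈ T, filledTriangle s = ⋃ s : ↥T, filledTriangle s.1 := by
    rw [Set.iUnion_subtype]
  rw [hX]
  refine nonempty_homotopyEquiv_nerveComplex (fun s => s.1.finite_toSet.isCompact_convexHull ℝ)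
    (fun s => convex_convexHull ℝ _) fun s => ?_
  have hcard : 0 < s.1.card := by
    rw [(hT s.1 s.2).2]
    exact three_pos
  exact (Finset.coe_nonempty.2 (Finset.card_pos.1 hcard)).convexHull
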